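/- Let $\alpha,\theta\in\mathbb R$ with $\theta/2\pi$ irrational, and let $f:\mathbb T\to\mathbb T$ be a continuous map of the unit circle $\mathbb T=\{z\in\mathbb C: |z|=1\}$. Let $\mathbb A_\alpha$ be the noncommutative $2$-torus, that is, the universal unital $C^*$-algebra generated by two unitaries $U,V$ subject to $UV=e^{2\pi i\alpha}VU$. Let $\tau$ be its canonical trace, that is, the state with $\tau(U^mV^n)=\delta_{m,0}\,\delta_{n,0}$ for $m,n\in\mathbb Z$. Let $\Phi_{\theta,f}$ be the Anzai skew-product, that is, the unital $*$-homomorphism $\mathbb A_\alpha\to\mathbb A_\alpha$ (in fact a $*$-automorphism) determined by $\Phi_{\theta,f}(U)=e^{i\theta}U$ and $\Phi_{\theta,f}(V)=f(U)V$, where $f(U)$ is given by the continuous functional calculus. Suppose that $(\mathbb A_\alpha,\Phi_{\theta,f},\tau)$ is ergodic, that is, $\tau$ is an extreme point of the convex set of $\Phi_{\theta,f}$-invariant states of $\mathbb A_\alpha$. Then $(\mathbb A_\alpha,\Phi_{\theta,f})$ is minimal: $\mathbb A_\alpha$ itself is the unique nonzero hereditary $C^*$-subalgebra $B\subseteq\mathbb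 A_\alpha$ with $\Phi_{\theta,f}(B)\subseteq B$. (A $C^*$-subalgebra $B$, i.e. a norm-closed $*$-subalgebra that need not contain the unit, is hereditary if $0\le a\le b$ with $b\in B$ and $a\in\mathbb A_\alpha$ implies $a\in B$.) -/

import Mathlib

open scoped ComplexOrder

noncomputable section

/-! ### The noncommutative torus as a universal C⋆-algebra -/

/-- The free unital `*`-algebra on two unitary indeterminates: the complex group algebra of the
free group on two generators, with involution `(c g)* = c̄ g⁻¹`.  The parameter `α` is the
deformation parameter, which enters through the norm below. -/
def PreNCTorus (_α : ℝ) : Type := MonoidAlgebra ℂ (FreeGroup (Fin 2))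

namespace PreNCTorus

variable {α : ℝ}

instance instRing : Ring (PreNCTorus α) :=
  inferInstanceAs (Ring (MonoidAlgebra ℂ (FreeGroup (Fin 2))))

instance instAlgebra : Algebra ℂ (PreNCTorus α) :=
  inferInstanceAs (Algebra ℂ (MonoidAlgebra ℂ (FreeGroup (Fin 2))))

/-- The monomial `c g`. -/
def mono (g : FreeGroup (Fin 2)) (c : ℂ) : PreNCTorus α := MonoidAlgebra.single g c

theorem mono_mul (g h : FreeGroup (Fin 2)) (c d : ℂ) :
    (mono g c * mono h d : PreNCTorus α) = mono (g * h) (c * d) :=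
  MonoidAlgebra.single_mul_single ..

theorem mono_one : (mono 1 1 : PreNCTorus α) = 1 := rfl

theorem smul_mono (g : FreeGroup (Fin 2)) (c d : ℂ) :
    (c • mono g d : PreNCTorus α) = mono g (c * d) :=
  MonoidAlgebra.smul_single ..

theorem induct {motive : PreNCTorus α → Prop} (x : PreNCTorus α)
    (h0 : motive 0) (hadd : ∀ x y, motive x → motive y → motive (x + y))
    (hs : ∀ g c, motive (mono g c)) : motive x :=
  MonoidAlgebra.induction_linear (motive := motive) x h0 hadd hs

/-- The involution, as an additive map. -/
def starHom : PreNCTorus α →+ PreNCTorus α where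
  toFun x := MonoidAlgebra.mapDomain (fun g => g⁻¹)
    (MonoidAlgebra.map (starRingEnd ℂ : ℂ →+ ℂ) x)
  map_zero' := by
    exact (congrArg _ (MonoidAlgebra.map_zero _)).trans (MonoidAlgebra.mapDomain_zero _)
  map_add' x y := by
    exact (congrArg _ (MonoidAlgebra.map_add _ _ _)).trans (MonoidAlgebra.mapDomain_add _ _ _)

theorem starHom_mono (g : FreeGroup (Fin 2)) (c : ℂ) :
    starHom (mono g c : PreNCTorus α) = mono g⁻¹ (star c) :=
  (congrArg _ (MonoidAlgebra.map_single _ _ _)).trans MonoidAlgebra.mapDomain_single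

theorem starHom_starHom (x : PreNCTorus α) : starHom (starHom x) = x := by
  induction x using induct with
  | h0 => simp
  | hadd x y hx hy => rw [map_add, map_add, hx, hy]
  | hs g c => rw [starHom_mono, starHom_mono, inv_inv, star_star]

theorem starHom_mul (x y : PreNCTorus α) : starHom (x * y) = starHom y * starHom x := by
  induction x using induct with
  | h0 => simp
  | hadd x x' hx hx' => rw [add_mul, map_add, map_add, mul_add, hx, hx']
  | hs g c =>
    induction y using induct with
    | h0 => simp
    | hadd y y' hy hy' => rw [mul_add, map_add, map_add, add_mul, hy, hy']
    | hs h d =>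
      rw [mono_mul, starHom_mono, starHom_mono, starHom_mono, mono_mul, mul_inv_rev, star_mul]

instance instStarRing : StarRing (PreNCTorus α) where
  star := starHom
  star_involutive := starHom_starHom
  star_mul := starHom_mul
  star_add := map_add starHom

theorem star_mono (g : FreeGroup (Fin 2)) (c : ℂ) :
    star (mono g c : PreNCTorus α) = mono g⁻¹ (star c) := starHom_mono g c

instance instStarModule : StarModule ℂ (PreNCTorus α) where
  star_smul c x := by
    induction x using induct with
    | h0 => simp
    | hadd x y hx hy => rw [smul_add, star_add, star_add, smul_add, hx, hy]
    | hs g d => rw [smul_mono, star_mono, star_mono, smul_mono, star_mul, mul_comm]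

/-- The first unitary indeterminate. -/
def genU : PreNCTorus α := mono (FreeGroup.of 0) 1

/-- The second unitary indeterminate. -/
def genV : PreNCTorus α := mono (FreeGroup.of 1) 1

variable (α) in
/-- The C⋆-seminorms on the free `*`-algebra on two unitaries for which the relation
`U V = e^{2πiα} V U` holds. -/
structure CStarSeminorm extends Seminorm ℂ (PreNCTorus α) where
  mul_le' : ∀ x y, toFun (x * y) ≤ toFun x * toFun y
  cstar' : ∀ x, toFun (star x * x) = toFun x * toFun x
  rel' : toFun (genU * genV - Complex.exp (2 * Real.pi * Complex.I * α) • (genV * genU)) = 0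

namespace CStarSeminorm

instance : Inhabited (CStarSeminorm α) where
  default :=
    { (0 : Seminorm ℂ (PreNCTorus α)) with
      mul_le' := fun x y => by
        change (0 : ℝ) ≤ 0 * 0
        simp
      cstar' := fun x => by
        change (0 : ℝ) = 0 * 0
        simp
      rel' := rfl }

variable (p : CStarSeminorm α)

theorem mul_le (x y : PreNCTorus α) :
    p.toSeminorm (x * y) ≤ p.toSeminorm x * p.toSeminorm y := p.mul_le' x y

theorem cstar (x : PreNCTorus α) :
    p.toSeminorm (star x * x) = p.toSeminorm x * p.toSeminorm x := p.cstar' x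

theorem le_one_of_idem {r : ℝ} (h : r = r * r) : r ≤ 1 := by nlinarith [sq_nonneg (r - 1)]

theorem mono_le (g : FreeGroup (Fin 2)) (c : ℂ) : p.toSeminorm (mono g c) ≤ ‖c‖ := by
  have h1 : p.toSeminorm (1 : PreNCTorus α) ≤ 1 := by
    refine le_one_of_idem ?_
    have := p.cstar 1
    rwa [star_one, mul_one] at this
  have h2 : p.toSeminorm (mono g 1) ≤ 1 := by
    have := p.cstar (mono g 1)
    rw [star_mono, mono_mul, inv_mul_cancel, star_one, mul_one, mono_one] at this
    nlinarith [apply_nonneg p.toSeminorm (mono g 1)]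
  have h3 : (mono g c : PreNCTorus α) = c • mono g 1 := by rw [smul_mono, mul_one]
  rw [h3, map_smul_eq_mul]
  exact mul_le_of_le_one_right (norm_nonneg c) h2

theorem star_eq (x : PreNCTorus α) : p.toSeminorm (star x) = p.toSeminorm x := by
  have key : ∀ y, p.toSeminorm y ≤ p.toSeminorm (star y) := by
    intro y
    by_contra! h
    have h1 := p.cstar y
    have h2 := p.mul_le (star y) y
    nlinarith [apply_nonneg p.toSeminorm (star y), apply_nonneg p.toSeminorm y]
  refine le_antisymm ?_ (key x)
  simpa using key (star x)

theorem bdd (x : PreNCTorus α) :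
    BddAbove (Set.range fun p : CStarSeminorm α => p.toSeminorm x) := by
  induction x using induct with
  | h0 => exact ⟨0, by rintro _ ⟨p, rfl⟩; simp⟩
  | hadd x y hx hy =>
    obtain ⟨a, ha⟩ := hx
    obtain ⟨b, hb⟩ := hy
    refine ⟨a + b, ?_⟩
    rintro _ ⟨p, rfl⟩
    exact (map_add_le_add _ _ _).trans (add_le_add (ha ⟨p, rfl⟩) (hb ⟨p, rfl⟩))
  | hs g c => exact ⟨‖c‖, by rintro _ ⟨p, rfl⟩; exact p.mono_le g c⟩

end CStarSeminorm

/-- The largest C⋆-seminorm for which `U V = e^{2πiα} V U`. -/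
def univNorm (x : PreNCTorus α) : ℝ := ⨆ p : CStarSeminorm α, p.toSeminorm x

theorem le_univNorm (p : CStarSeminorm α) (x : PreNCTorus α) : p.toSeminorm x ≤ univNorm x :=
  le_ciSup (CStarSeminorm.bdd x) p

theorem univNorm_le {x : PreNCTorus α} {r : ℝ}
    (h : ∀ p : CStarSeminorm α, p.toSeminorm x ≤ r) : univNorm x ≤ r := ciSup_le h

theorem univNorm_nonneg (x : PreNCTorus α) : 0 ≤ univNorm x :=
  (apply_nonneg _ x).trans (le_univNorm default x)

theorem univNorm_add (x y : PreNCTorus α) : univNorm (x + y) ≤ univNorm x + univNorm y :=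
  univNorm_le fun p =>
    (map_add_le_add _ _ _).trans (add_le_add (le_univNorm p x) (le_univNorm p y))

theorem univNorm_smul (c : ℂ) (x : PreNCTorus α) : univNorm (c • x) = ‖c‖ * univNorm x := by
  simp only [univNorm, map_smul_eq_mul]
  exact (Real.mul_iSup_of_nonneg (norm_nonneg c) _).symm

theorem univNorm_mul (x y : PreNCTorus α) : univNorm (x * y) ≤ univNorm x * univNorm y :=
  univNorm_le fun p => (p.mul_le x y).trans <|
    mul_le_mul (le_univNorm p x) (le_univNorm p y) (apply_nonneg _ _) (univNorm_nonneg x)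

theorem univNorm_star (x : PreNCTorus α) : univNorm (star x) = univNorm x := by
  simp only [univNorm, CStarSeminorm.star_eq]

theorem univNorm_cstar (x : PreNCTorus α) :
    univNorm x * univNorm x ≤ univNorm (star x * x) := by
  have h : univNorm x ≤ Real.sqrt (univNorm (star x * x)) :=
    univNorm_le fun p => Real.le_sqrt_of_sq_le <| by
      rw [sq, ← p.cstar]
      exact le_univNorm p _
  calc univNorm x * univNorm x
      ≤ Real.sqrt (univNorm (star x * x)) * Real.sqrt (univNorm (star x * x)) :=
        mul_self_le_mul_self (univNorm_nonneg x) h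
    _ = _ := Real.mul_self_sqrt (univNorm_nonneg _)

instance instNorm : Norm (PreNCTorus α) := ⟨univNorm⟩

instance instSeminormedAddCommGroup : SeminormedAddCommGroup (PreNCTorus α) :=
  SeminormedAddCommGroup.ofCore (𝕜 := ℂ)
    { norm_nonneg := univNorm_nonneg
      norm_smul := univNorm_smul
      norm_triangle := univNorm_add }

instance instSeminormedRing : SeminormedRing (PreNCTorus α) :=
  { instSeminormedAddCommGroup, instRing with
    norm_mul_le := univNorm_mul }

instance instNormedAlgebra : NormedAlgebra ℂ (PreNCTorus α) :=
  { instAlgebra with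
    norm_smul_le := fun c x => (univNorm_smul c x).le }

theorem norm_def (x : PreNCTorus α) : ‖x‖ = univNorm x := rfl

instance instNormedStarGroup : NormedStarGroup (PreNCTorus α) :=
  ⟨fun x => (univNorm_star x).le⟩

end PreNCTorus

/-- The noncommutative torus `𝔸_α`: the Hausdorff completion of the free `*`-algebra on two
unitary indeterminates in the largest C⋆-seminorm for which `U V = e^{2πiα} V U`. -/
def NCTorus (α : ℝ) : Type := UniformSpace.Completion (PreNCTorus α)

namespace NCTorus

open UniformSpace

variable {α : ℝ}

instance instNormedRing : NormedRing (NCTorus α) :=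
  inferInstanceAs (NormedRing (Completion (PreNCTorus α)))

instance instCompleteSpace : CompleteSpace (NCTorus α) :=
  inferInstanceAs (CompleteSpace (Completion (PreNCTorus α)))

instance instNormedAlgebra : NormedAlgebra ℂ (NCTorus α) :=
  { (inferInstanceAs (Algebra ℂ (Completion (PreNCTorus α))) : Algebra ℂ (NCTorus α)) with
    norm_smul_le := fun c x =>
      (norm_smul_le c (show Completion (PreNCTorus α) from x) :) }

/-- The canonical map from the free `*`-algebra. -/
def of (x : PreNCTorus α) : NCTorus α := (x : Completion (PreNCTorus α))

theorem continuous_of : Continuous (of : PreNCTorus α → NCTorus α) :=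
  Completion.continuous_coe _

theorem norm_of (x : PreNCTorus α) : ‖of x‖ = ‖x‖ := Completion.norm_coe x
theorem of_add (x y : PreNCTorus α) : of (x + y) = of x + of y := Completion.coe_add x y
theorem of_mul (x y : PreNCTorus α) : of (x * y) = of x * of y := Completion.coe_mul x y
theorem of_one : of (1 : PreNCTorus α) = 1 := Completion.coe_one _
theorem of_zero : of (0 : PreNCTorus α) = 0 := Completion.coe_zero
theorem of_sub (x y : PreNCTorus α) : of (x - y) = of x - of y := Completion.coe_sub x y
theorem of_smul (c : ℂ) (x : PreNCTorus α) : of (c • x) = c • of x := Completion.coe_smul c x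

theorem denseRange_of : DenseRange (of : PreNCTorus α → NCTorus α) := Completion.denseRange_coe

theorem induct {motive : NCTorus α → Prop} (x : NCTorus α)
    (hc : IsClosed {x | motive x}) (h : ∀ x, motive (of x)) : motive x :=
  Completion.induction_on x hc h

theorem induct₂ {motive : NCTorus α → NCTorus α → Prop} (x y : NCTorus α)
    (hc : IsClosed {z : NCTorus α × NCTorus α | motive z.1 z.2})
    (h : ∀ x y, motive (of x) (of y)) : motive x y :=
  Completion.induction_on₂ x y hc h

/-- The involution, extended by continuity. -/
def starMap : NCTorus α → NCTorus α :=
  Completion.map (star : PreNCTorus α → PreNCTorus α)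

theorem continuous_starMap : Continuous (starMap : NCTorus α → NCTorus α) :=
  Completion.continuous_map

theorem starMap_of (x : PreNCTorus α) : starMap (of x) = of (star x) :=
  Completion.map_coe (starₗᵢ ℂ (E := PreNCTorus α)).isometry.uniformContinuous x

instance instStarRing : StarRing (NCTorus α) where
  star := starMap
  star_involutive x := by
    refine induct (motive := fun x => starMap (starMap x) = x) x
      (isClosed_eq (continuous_starMap.comp continuous_starMap) continuous_id) ?_
    intro x
    rw [starMap_of, starMap_of, star_star]
  star_mul x y := by
    refine induct₂ (motive := fun x y => starMap (x * y) = starMap y * starMap x) x y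
      (isClosed_eq (continuous_starMap.comp continuous_mul)
      ((continuous_starMap.comp continuous_snd).mul
        (continuous_starMap.comp continuous_fst))) ?_
    intro x y
    rw [← of_mul, starMap_of, starMap_of, starMap_of, star_mul, of_mul]
  star_add x y := by
    refine induct₂ (motive := fun x y => starMap (x + y) = starMap x + starMap y) x y
      (isClosed_eq (continuous_starMap.comp continuous_add)
      ((continuous_starMap.comp continuous_fst).add
        (continuous_starMap.comp continuous_snd))) ?_
    intro x y
    rw [← of_add, starMap_of, starMap_of, starMap_of, star_add, of_add]

theorem star_of (x : PreNCTorus α) : star (of x) = of (star x) := starMap_of x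

theorem continuous_star' : Continuous (star : NCTorus α → NCTorus α) := continuous_starMap

instance instStarModule : StarModule ℂ (NCTorus α) where
  star_smul c x := by
    refine induct (motive := fun x => star (c • x) = star c • star x) x
      (isClosed_eq (continuous_star'.comp (continuous_const_smul c))
      (continuous_star'.const_smul (star c))) ?_
    intro x
    rw [← of_smul, star_of, star_of, star_smul, of_smul]

instance instCStarRing : CStarRing (NCTorus α) where
  norm_mul_self_le x := by
    refine induct (motive := fun x => ‖x‖ * ‖x‖ ≤ ‖star x * x‖) x
      (isClosed_le (continuous_norm.mul continuous_norm)
      (continuous_norm.comp (continuous_star'.mul continuous_id))) ?_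
    intro x
    rw [star_of, ← of_mul, norm_of, norm_of]
    exact PreNCTorus.univNorm_cstar x

instance instCStarAlgebra : CStarAlgebra (NCTorus α) where

instance instPartialOrder : PartialOrder (NCTorus α) := CStarAlgebra.spectralOrder _

instance instStarOrderedRing : StarOrderedRing (NCTorus α) := CStarAlgebra.spectralOrderedRing _

theorem of_mono_mem_unitary (g : FreeGroup (Fin 2)) :
    of (PreNCTorus.mono g 1) ∈ unitary (NCTorus α) := by
  constructor <;>
  simp [star_of, ← of_mul, PreNCTorus.star_mono, PreNCTorus.mono_mul, PreNCTorus.mono_one, of_one]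

variable (α) in
/-- The unitary generator `U` of `𝔸_α`. -/
def U : unitary (NCTorus α) := ⟨of PreNCTorus.genU, of_mono_mem_unitary _⟩

variable (α) in
/-- The unitary generator `V` of `𝔸_α`. -/
def V : unitary (NCTorus α) := ⟨of PreNCTorus.genV, of_mono_mem_unitary _⟩

/-- The defining commutation relation for a pair of elements. -/
def Rel (α : ℝ) {B : Type*} [Mul B] [SMul ℂ B] (u v : B) : Prop :=
  u * v = Complex.exp (2 * Real.pi * Complex.I * α) • (v * u)

variable (α) in
theorem rel_U_V : Rel α (U α : NCTorus α) (V α) := by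
  unfold Rel U V
  rw [← sub_eq_zero, ← norm_eq_zero, ← of_mul, ← of_mul, ← of_smul, ← of_sub, norm_of]
  refine le_antisymm (PreNCTorus.univNorm_le fun p => ?_) (norm_nonneg _)
  exact p.rel'.le

/-! ### The universal property -/

section Lift

variable {B : Type*} [CStarAlgebra B]

/-- The unital `*`-homomorphism on the free `*`-algebra determined by two unitaries. -/
def preLift (u v : unitary B) : PreNCTorus α →ₐ[ℂ] B :=
  (MonoidAlgebra.lift ℂ B (FreeGroup (Fin 2))
    ((unitary B).subtype.comp (FreeGroup.lift ![u, v])) :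
      MonoidAlgebra ℂ (FreeGroup (Fin 2)) →ₐ[ℂ] B)

theorem preLift_mono (u v : unitary B) (g : FreeGroup (Fin 2)) (c : ℂ) :
    preLift (α := α) u v (PreNCTorus.mono g c) = c • (FreeGroup.lift ![u, v] g : B) :=
  MonoidAlgebra.lift_single _ _ _

theorem preLift_genU (u v : unitary B) : preLift (α := α) u v PreNCTorus.genU = u := by
  simp [PreNCTorus.genU, preLift_mono]

theorem preLift_genV (u v : unitary B) : preLift (α := α) u v PreNCTorus.genV = v := by
  simp [PreNCTorus.genV, preLift_mono]

theorem preLift_star (u v : unitary B) (x : PreNCTorus α) :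
    preLift u v (star x) = star (preLift u v x) := by
  induction x using PreNCTorus.induct with
  | h0 => simp
  | hadd x y hx hy => rw [star_add, map_add, map_add, star_add, hx, hy]
  | hs g c =>
    rw [PreNCTorus.star_mono, preLift_mono, preLift_mono, map_inv, star_smul]
    rfl

/-- The C⋆-seminorm induced by a pair of unitaries satisfying the commutation relation. -/
def inducedSeminorm (u v : unitary B) (h : Rel α (u : B) v) : PreNCTorus.CStarSeminorm α :=
  { (normSeminorm ℂ B).comp (preLift (α := α) u v).toLinearMap with
    mul_le' := fun x y => by
      change ‖preLift u v (x * y)‖ ≤ ‖preLift u v x‖ * ‖preLift u v y‖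
      rw [map_mul]
      exact norm_mul_le _ _
    cstar' := fun x => by
      change ‖preLift u v (star x * x)‖ = ‖preLift u v x‖ * ‖preLift u v x‖
      rw [map_mul, preLift_star]
      exact CStarRing.norm_star_mul_self
    rel' := by
      change ‖preLift u v _‖ = 0
      rw [map_sub, map_smul, map_mul, map_mul, preLift_genU, preLift_genV, norm_eq_zero,
        sub_eq_zero]
      exact h }

theorem norm_preLift_le (u v : unitary B) (h : Rel α (u : B) v) (x : PreNCTorus α) :
    ‖preLift u v x‖ ≤ ‖x‖ :=
  PreNCTorus.le_univNorm (inducedSeminorm u v h) x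

theorem uniformContinuous_preLift (u v : unitary B) (h : Rel α (u : B) v) :
    UniformContinuous (preLift (α := α) u v) :=
  ((preLift (α := α) u v).toLinearMap.mkContinuous 1
    fun x => (norm_preLift_le u v h x).trans (one_mul _).ge).uniformContinuous

/-- The continuous extension of `preLift`, as a map. -/
def liftFun (u v : unitary B) (_h : Rel α (u : B) v) : NCTorus α → B :=
  Completion.extension (preLift (α := α) u v)

theorem liftFun_of (u v : unitary B) (h : Rel α (u : B) v) (x : PreNCTorus α) :
    liftFun u v h (of x) = preLift u v x :=
  Completion.extension_coe (uniformContinuous_preLift u v h) x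

theorem continuous_liftFun (u v : unitary B) (h : Rel α (u : B) v) :
    Continuous (liftFun u v h) := Completion.continuous_extension

/-- The universal property of `𝔸_α`: a pair of unitaries `u, v` of a unital C⋆-algebra with
`u v = e^{2πiα} v u` determines a unital `*`-homomorphism with `U ↦ u` and `V ↦ v`. -/
def lift (u v : unitary B) (h : Rel α (u : B) v) : NCTorus α →⋆ₐ[ℂ] B where
  toFun := liftFun u v h
  map_one' := by rw [← of_one, liftFun_of, map_one]
  map_mul' x y := by
    have hc := continuous_liftFun u v h
    refine induct₂ (motive := fun x y =>
      liftFun u v h (x * y) = liftFun u v h x * liftFun u v h y) x y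
      (isClosed_eq (hc.comp continuous_mul)
      ((hc.comp continuous_fst).mul (hc.comp continuous_snd))) ?_
    intro x y
    rw [← of_mul, liftFun_of, liftFun_of, liftFun_of, map_mul]
  map_zero' := by rw [← of_zero, liftFun_of, map_zero]
  map_add' x y := by
    have hc := continuous_liftFun u v h
    refine induct₂ (motive := fun x y =>
      liftFun u v h (x + y) = liftFun u v h x + liftFun u v h y) x y
      (isClosed_eq (hc.comp continuous_add)
      ((hc.comp continuous_fst).add (hc.comp continuous_snd))) ?_
    intro x y
    rw [← of_add, liftFun_of, liftFun_of, liftFun_of, map_add]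
  commutes' c := by
    rw [Algebra.algebraMap_eq_smul_one, ← of_one, ← of_smul, liftFun_of, map_smul, map_one,
      Algebra.algebraMap_eq_smul_one]
  map_star' x := by
    have hc := continuous_liftFun u v h
    refine induct (motive := fun x => liftFun u v h (star x) = star (liftFun u v h x)) x
      (isClosed_eq (hc.comp continuous_star') hc.star) ?_
    intro x
    rw [star_of, liftFun_of, liftFun_of, preLift_star]

theorem lift_U (u v : unitary B) (h : Rel α (u : B) v) : lift u v h (U α) = u :=
  (liftFun_of u v h _).trans (preLift_genU u v)

theorem lift_V (u v : unitary B) (h : Rel α (u : B) v) : lift u v h (V α) = v :=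
  (liftFun_of u v h _).trans (preLift_genV u v)

/-- Uniqueness in the universal property. -/
theorem hom_ext {φ ψ : NCTorus α →⋆ₐ[ℂ] B} (hU : φ (U α) = ψ (U α)) (hV : φ (V α) = ψ (V α)) :
    φ = ψ := by
  have hg : ∀ g : FreeGroup (Fin 2),
      φ (of (PreNCTorus.mono g 1)) = ψ (of (PreNCTorus.mono g 1)) := by
    intro g
    induction g using FreeGroup.induction_on with
    | C1 => rw [PreNCTorus.mono_one, of_one, map_one, map_one]
    | of i => fin_cases i; exacts [hU, hV]
    | inv_of i hi =>
      rw [← star_one ℂ, ← PreNCTorus.star_mono, ← star_of, map_star, map_star, hi]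
    | mul g h hg hh =>
      rw [← mul_one (1 : ℂ), ← PreNCTorus.mono_mul, of_mul, map_mul, map_mul, hg, hh]
  ext x
  refine induct (motive := fun x => φ x = ψ x) x
    (isClosed_eq
    (AddMonoidHomClass.continuous_of_bound φ 1 fun a => by
      simpa using NonUnitalStarAlgHom.norm_apply_le φ a)
    (AddMonoidHomClass.continuous_of_bound ψ 1 fun a => by
      simpa using NonUnitalStarAlgHom.norm_apply_le ψ a)) ?_
  intro x
  induction x using PreNCTorus.induct with
  | h0 => rw [of_zero, map_zero, map_zero]
  | hadd x y hx hy => rw [of_add, map_add, map_add, hx, hy]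
  | hs g c => rw [← mul_one c, ← PreNCTorus.smul_mono, of_smul, map_smul, map_smul, hg]

end Lift

/-! ### The canonical trace -/

/-- The Hilbert space `ℓ²(ℤ × ℤ)`. -/
abbrev L2 : Type := lp (fun _ : ℤ × ℤ => ℂ) 2

/-- The weighted permutation `(W ξ)(k) = c(k) ξ(σ k)` with unimodular weights `c`. -/
def weighted (σ : Equiv.Perm (ℤ × ℤ)) (c : ℤ × ℤ → Circle) : L2 →ₗᵢ[ℂ] L2 where
  toFun ξ := ⟨fun k => (c k : ℂ) * ξ (σ k), by
    have h := (memℓp_gen_iff (by norm_num : 0 < (2 : ENNReal).toReal)).1 (lp.memℓp ξ)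
    refine memℓp_gen ?_
    simpa [Function.comp_def, Circle.norm_coe] using σ.summable_iff.2 h⟩
  map_add' ξ η := by
    ext k
    exact mul_add _ _ _
  map_smul' a ξ := by
    ext k
    exact mul_left_comm _ _ _
  norm_map' ξ := by
    have h2 : 0 < (2 : ENNReal).toReal := by norm_num
    rw [lp.norm_eq_tsum_rpow h2, lp.norm_eq_tsum_rpow h2]
    congr 1
    refine Eq.trans ?_ (σ.tsum_eq fun k => ‖ξ k‖ ^ (2 : ENNReal).toReal)
    simp [Circle.norm_coe]

theorem weighted_apply (σ : Equiv.Perm (ℤ × ℤ)) (c : ℤ × ℤ → Circle) (ξ : L2) (k : ℤ × ℤ) :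
    weighted σ c ξ k = c k * ξ (σ k) := rfl

theorem weighted_surjective (σ : Equiv.Perm (ℤ × ℤ)) (c : ℤ × ℤ → Circle) :
    Function.Surjective (weighted σ c) := by
  intro ξ
  refine ⟨weighted σ.symm (fun k => (c (σ.symm k))⁻¹) ξ, ?_⟩
  ext k
  simp [weighted_apply]

/-- A weighted permutation as a unitary operator on `ℓ²(ℤ × ℤ)`. -/
def weightedUnitary (σ : Equiv.Perm (ℤ × ℤ)) (c : ℤ × ℤ → Circle) : unitary (L2 →L[ℂ] L2) :=
  Unitary.linearIsometryEquiv.symm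
    (LinearIsometryEquiv.ofSurjective (weighted σ c) (weighted_surjective σ c))

theorem weightedUnitary_apply (σ : Equiv.Perm (ℤ × ℤ)) (c : ℤ × ℤ → Circle) (ξ : L2)
    (k : ℤ × ℤ) : (weightedUnitary σ c : L2 →L[ℂ] L2) ξ k = c k * ξ (σ k) := rfl

/-- The shift `e_{mn} ↦ e_{m+1,n}`. -/
def regU : unitary (L2 →L[ℂ] L2) := weightedUnitary (Equiv.subRight (1, 0)) 1

variable (α) in
/-- The weighted shift `e_{mn} ↦ e^{-2πiαm} e_{m,n+1}`. -/
def regV : unitary (L2 →L[ℂ] L2) :=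
  weightedUnitary (Equiv.subRight (0, 1)) fun k => Circle.exp (-(2 * Real.pi * α * k.1))

theorem rel_regU_regV : Rel α (regU : L2 →L[ℂ] L2) (regV α) := by
  unfold Rel
  ext ξ k
  change (regU : L2 →L[ℂ] L2) ((regV α : L2 →L[ℂ] L2) ξ) k =
    Complex.exp _ * (regV α : L2 →L[ℂ] L2) ((regU : L2 →L[ℂ] L2) ξ) k
  have hk : k - (1, 0) - (0, 1) = k - (0, 1) - (1, 0) := sub_right_comm _ _ _
  simp only [regU, regV, weightedUnitary_apply, Equiv.subRight_apply, Pi.one_apply, hk,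
    Circle.coe_one, one_mul, Circle.coe_exp, ← mul_assoc, ← Complex.exp_add]
  congr 2
  simp
  ring

variable (α) in
/-- The regular representation of `𝔸_α` on `ℓ²(ℤ × ℤ)`, with `e_{mn} = U^m V^n e_{00}`. -/
def reg : NCTorus α →⋆ₐ[ℂ] (L2 →L[ℂ] L2) := lift regU (regV α) rel_regU_regV

variable (α) in
/-- The canonical trace `τ(a) = ⟪e₀₀, a e₀₀⟫`, so that `τ(U^m V^n) = δ_{m,0} δ_{n,0}`. -/
def trace : StrongDual ℂ (NCTorus α) :=
  LinearMap.mkContinuous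
    { toFun := fun a => inner ℂ (lp.single 2 (0, 0) 1 : L2) (reg α a (lp.single 2 (0, 0) 1))
      map_add' := fun a b => by simp
      map_smul' := fun c a => by simp } 1 <| fun a => by
    have he : ‖(lp.single 2 (0, 0) 1 : L2)‖ = 1 := by
      rw [lp.norm_single (by norm_num)]
      simp
    calc ‖inner ℂ (lp.single 2 (0, 0) 1 : L2) (reg α a (lp.single 2 (0, 0) 1))‖
        ≤ ‖(lp.single 2 (0, 0) 1 : L2)‖ * ‖reg α a (lp.single 2 (0, 0) 1)‖ :=
          norm_inner_le_norm _ _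
      _ ≤ ‖(lp.single 2 (0, 0) 1 : L2)‖ * (‖reg α a‖ * ‖(lp.single 2 (0, 0) 1 : L2)‖) := by
          gcongr
          exact (reg α a).le_opNorm _
      _ ≤ 1 * ‖a‖ := by
          rw [he, mul_one, one_mul, one_mul]
          exact NonUnitalStarAlgHom.norm_apply_le (reg α) a

theorem regU_zpow (m : ℤ) (ξ : L2) (k : ℤ × ℤ) :
    ((regU ^ m : unitary (L2 →L[ℂ] L2)) : L2 →L[ℂ] L2) ξ k = ξ (k.1 - m, k.2) := by
  have h1 : ∀ (ξ : L2) (k : ℤ × ℤ), (regU : L2 →L[ℂ] L2) ξ k = ξ (k.1 - 1, k.2) := by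
    intro ξ k
    have : (k.1 - 1, k.2) = k - ((1 : ℤ), (0 : ℤ)) := by ext <;> simp
    rw [this]
    exact one_mul _
  have hm : ∀ (m : ℤ) (ξ : L2) (k : ℤ × ℤ), ((regU ^ (m + 1) : unitary (L2 →L[ℂ] L2)) : L2 →L[ℂ] L2) ξ k =
      ((regU ^ m : unitary (L2 →L[ℂ] L2)) : L2 →L[ℂ] L2) ξ (k.1 - 1, k.2) := by
    intro m ξ k
    rw [add_comm, zpow_add, zpow_one]
    exact h1 _ k
  induction m using Int.induction_on generalizing k with
  | zero => simp
  | succ i ih => rw [hm, ih, sub_sub, add_comm (1 : ℤ)]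
  | pred i ih =>
    have := hm (-i - 1) ξ (k.1 + 1, k.2)
    simp only [sub_add_cancel, add_sub_cancel_right] at this
    rw [← this, ih, show k.1 + 1 - -(i : ℤ) = k.1 - (-i - 1) by ring]

theorem regV_zpow (n : ℤ) (ξ : L2) :
   ∀ k : ℤ × ℤ, ∃ c : Circle,
    ((regV α ^ n : unitary (L2 →L[ℂ] L2)) : L2 →L[ℂ] L2) ξ k = c * ξ (k.1, k.2 - n) := by
  have hm : ∀ (m : ℤ) (k : ℤ × ℤ), ∃ c : Circle, ((regV α ^ (m + 1) : unitary (L2 →L[ℂ] L2)) : L2 →L[ℂ] L2) ξ k =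
      c * ((regV α ^ m : unitary (L2 →L[ℂ] L2)) : L2 →L[ℂ] L2) ξ (k.1, k.2 - 1) := by
    intro m k
    refine ⟨Circle.exp (-(2 * Real.pi * α * k.1)), ?_⟩
    rw [add_comm, zpow_add, zpow_one]
    have : (k.1, k.2 - 1) = k - ((0 : ℤ), (1 : ℤ)) := by ext <;> simp
    rw [this]
    rfl
  induction n using Int.induction_on with
  | zero => intro k; exact ⟨1, by simp⟩
  | succ i ih =>
    intro k
    obtain ⟨c, hc⟩ := hm i k
    obtain ⟨d, hd⟩ := ih (k.1, k.2 - 1)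
    refine ⟨c * d, ?_⟩
    rw [hc, hd, Circle.coe_mul, mul_assoc, sub_sub, add_comm (1 : ℤ)]
  | pred i ih =>
    intro k
    obtain ⟨c, hc⟩ := hm (-i-1) (k.1, k.2 + 1)
    obtain ⟨d, hd⟩ := ih (k.1, k.2 + 1)
    simp only [sub_add_cancel, add_sub_cancel_right] at hc
    refine ⟨c⁻¹ * d, ?_⟩
    rw [hc] at hd
    rw [Circle.coe_mul, mul_assoc, show k.2 - (-(i:ℤ) - 1) = k.2 + 1 - -i by ring, ← hd, ← mul_assoc, ← Circle.coe_mul]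
    simp

/-- The formula `τ(U^m V^n) = δ_{m,0} δ_{n,0}` for the canonical trace. -/
theorem trace_monomial (m n : ℤ) :
    trace α ((U α ^ m * V α ^ n : unitary (NCTorus α)) : NCTorus α) =
      if m = 0 ∧ n = 0 then 1 else 0 := by
  have key : reg α ((U α ^ m * V α ^ n : unitary (NCTorus α)) : NCTorus α) =
      ((regU ^ m * regV α ^ n : unitary (L2 →L[ℂ] L2)) : L2 →L[ℂ] L2) := by
    let r : unitary (NCTorus α) →* unitary (L2 →L[ℂ] L2) :=
      { toFun := fun u => ⟨reg α u, Unitary.map_mem (reg α) u.2⟩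
        map_one' := Subtype.ext (map_one (reg α))
        map_mul' := fun u v => Subtype.ext (map_mul (reg α) _ _) }
    have hu : r (U α) = regU := Subtype.ext (lift_U _ _ _)
    have hv : r (V α) = regV α := Subtype.ext (lift_V _ _ _)
    have h : r (U α ^ m * V α ^ n) = regU ^ m * regV α ^ n := by
      rw [map_mul, map_zpow, map_zpow, hu, hv]
    exact congrArg Subtype.val h
  change inner ℂ (lp.single 2 (0, 0) 1 : L2) (reg α _ (lp.single 2 (0, 0) 1)) = _
  rw [key, lp.inner_single_left]
  obtain ⟨c, hc⟩ := regV_zpow (α := α) n (lp.single 2 (0, 0) 1) (0 - m, 0)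
  have h2 := regU_zpow m (((regV α ^ n : unitary (L2 →L[ℂ] L2)) : L2 →L[ℂ] L2) (lp.single 2 (0, 0) 1)) (0,0)
  rw [Submonoid.coe_mul]
  change inner ℂ (1:ℂ) ((((regU ^ m : unitary (L2 →L[ℂ] L2)) : L2 →L[ℂ] L2) _ : L2) (0,0)) = _
  refine (congrArg (inner ℂ (1 : ℂ)) (h2.trans hc)).trans ?_
  by_cases h : m = 0 ∧ n = 0
  · obtain ⟨rfl, rfl⟩ := h
    simp at hc ⊢
    exact hc.symm
  · rw [if_neg h, lp.single_apply_ne]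
    · simp
    · simpa [Prod.ext_iff] using h

/-! ### The Anzai skew-product -/

/-- A continuous map `f : 𝕋 → 𝕋` as a function on `ℂ` (the values off the circle play no role). -/
def circleFun (f : C(Circle, Circle)) : ℂ → ℂ :=
  Function.extend ((↑) : Circle → ℂ) (fun z => (f z : ℂ)) 0

theorem circleFun_coe (f : C(Circle, Circle)) (z : Circle) : circleFun f z = f z :=
  Circle.coe_injective.extend_apply _ _ _

theorem continuousOn_circleFun (f : C(Circle, Circle)) :
    ContinuousOn (circleFun f) (Submonoid.unitSphere ℂ : Set ℂ) := by
  rw [continuousOn_iff_continuous_domRestrict]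
  have h : (Submonoid.unitSphere ℂ : Set ℂ).domRestrict (circleFun f) =
      fun z : Circle => (f z : ℂ) := funext fun z => circleFun_coe f z
  rw [h]
  exact continuous_subtype_val.comp f.continuous

variable (α) in
theorem spectrum_U_subset : spectrum ℂ (U α : NCTorus α) ⊆ (Submonoid.unitSphere ℂ : Set ℂ) :=
  spectrum.subset_circle_of_unitary (U α).2

/-- `f(U)`, in the sense of the continuous functional calculus. -/
def evalU (f : C(Circle, Circle)) : unitary (NCTorus α) :=
  ⟨cfc (circleFun f) (U α : NCTorus α), by
    rw [cfc_unitary_iff _ _ (isStarNormal_of_mem_unitary (U α).2)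
      ((continuousOn_circleFun f).mono (spectrum_U_subset α))]
    intro z hz
    have h := circleFun_coe f ⟨z, spectrum_U_subset α hz⟩
    change circleFun f z = _ at h
    rw [h, Complex.star_def, ← Circle.coe_inv_eq_conj, ← Circle.coe_mul, inv_mul_cancel,
      Circle.coe_one]⟩

/-- `e^{iθ} U`. -/
def rotU (θ : ℝ) : unitary (NCTorus α) :=
  ⟨(Circle.exp θ : ℂ) • (U α : NCTorus α), by
    have h : star (Circle.exp θ : ℂ) * Circle.exp θ = 1 := by
      rw [Complex.star_def, ← Circle.coe_inv_eq_conj, ← Circle.coe_mul, inv_mul_cancel,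
        Circle.coe_one]
    constructor
    · rw [star_smul, smul_mul_smul_comm, h, one_smul, Unitary.coe_star_mul_self]
    · rw [star_smul, smul_mul_smul_comm, mul_comm, h, one_smul]
      exact Unitary.coe_mul_star_self (U α)⟩

theorem rel_anzai (θ : ℝ) (f : C(Circle, Circle)) :
    Rel α ((rotU θ : unitary (NCTorus α)) : NCTorus α) (evalU f * V α : unitary (NCTorus α)) := by
  have hc : Commute (U α : NCTorus α) ((evalU f : unitary (NCTorus α)) : NCTorus α) := by
    refine (Commute.cfc (Commute.refl _) ?_ _).symm
    exact (Unitary.coe_star_mul_self (U α)).trans (Unitary.coe_mul_star_self (U α)).symm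
  have hr := rel_U_V α
  unfold Rel at hr ⊢
  simp only [rotU, Submonoid.coe_mul, smul_mul_assoc, mul_smul_comm]
  rw [← mul_assoc, hc.eq, mul_assoc, hr, mul_smul_comm, smul_comm, ← mul_assoc]

/-- The Anzai skew-product `Φ_{θ,f}`, determined by `U ↦ e^{iθ} U` and `V ↦ f(U) V`. -/
def anzai (θ : ℝ) (f : C(Circle, Circle)) : NCTorus α →⋆ₐ[ℂ] NCTorus α :=
  lift (rotU θ) (evalU f * V α) (rel_anzai θ f)

theorem anzai_U (θ : ℝ) (f : C(Circle, Circle)) :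
    anzai θ f (U α : NCTorus α) = (Circle.exp θ : ℂ) • (U α : NCTorus α) :=
  lift_U _ _ (rel_anzai θ f)

theorem anzai_V (θ : ℝ) (f : C(Circle, Circle)) :
    anzai θ f (V α : NCTorus α) =
      cfc (circleFun f) (U α : NCTorus α) * (V α : NCTorus α) :=
  lift_V _ _ (rel_anzai θ f)

end NCTorus

/-! ### Ergodicity and minimality -/

section Dynamics

variable {A : Type*} [CStarAlgebra A]

/-- The states of `A`: the positive linear functionals with `φ(1) = 1`. -/
def IsState (φ : StrongDual ℂ A) : Prop := (∀ a, 0 ≤ φ (star a * a)) ∧ φ 1 = 1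

/-- The convex set of states which are invariant under `Φ`. -/
def invariantStates (Φ : A →⋆ₐ[ℂ] A) : Set (StrongDual ℂ A) :=
  {φ | IsState φ ∧ ∀ a, φ (Φ a) = φ a}

/-- `(A, Φ, φ)` is ergodic: `φ` is an extreme point of the set of invariant states. -/
def IsErgodicState (Φ : A →⋆ₐ[ℂ] A) (φ : StrongDual ℂ A) : Prop :=
  φ ∈ Set.extremePoints ℝ (invariantStates Φ)

/-- A hereditary C⋆-subalgebra: a norm-closed `*`-subalgebra `B` (not necessarily containing the
unit) such that `0 ≤ a ≤ b` and `b ∈ B` imply `a ∈ B`. -/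
def IsHereditary [PartialOrder A] (B : NonUnitalStarSubalgebra ℂ A) : Prop :=
  IsClosed (B : Set A) ∧ ∀ a b : A, 0 ≤ a → a ≤ b → b ∈ B → a ∈ B

/-- `(A, Φ)` is minimal: `A` itself is the unique nontrivial (nonzero) hereditary C⋆-subalgebra
`B` of `A` with `Φ(B) ⊆ B`. -/
def IsMinimalSystem [PartialOrder A] (Φ : A →⋆ₐ[ℂ] A) : Prop :=
  ∀ B : NonUnitalStarSubalgebra ℂ A,
    (IsHereditary B ∧ (∀ b ∈ B, Φ b ∈ B) ∧ B ≠ ⊥) ↔ B = ⊤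

end Dynamics

end

/-! Minimality follows from unique ergodicity with respect to a faithful state. Let `B` be an
invariant hereditary subalgebra with `B ≠ ⊤`. It contains no invertible element
(`IsHereditary.eq_top_of_isUnit_mem`), so it stays at distance at least 1 from the unit, and
Hahn–Banach gives a state annihilating `B` (`exists_isState_forall_mem_eq_zero`). Since `Φ(B) ⊆ B`,
a weak-* limit of Cesàro averages of that state is an invariant state that still annihilates `B`. If
the trace is the only invariant state, it kills every `b* b` with `b ∈ B`; faithfulness then gives
`B = 0`.

Both facts about the trace come from the action of the two-torus rotating `U` and `V`. Averaging any
state over the whole torus yields the trace, and the average of a continuous nonnegative function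
vanishes only if the function does; this is faithfulness.

For uniqueness (`eq_trace_of_mem_invariantStates`), irrationality of the rotation forces an
invariant state `φ` to vanish on `U^m` for `m ≠ 0`. Rotations of `V` commute with the skew-product,
so averaging `φ` over them with the weights `1 ± cos (n t)` gives two more invariant states. Their
midpoint is the trace, so by extremality both equal it; but their values at `U^m V^n` are `± φ(U^m
V^n) / 2`, which must therefore be zero. -/

noncomputable section

/-! ### States obtained from Hahn–Banach. -/

section States

variable {A : Type*} [CStarAlgebra A]

/-- By the C⋆-identity the left side is the norm of `a² + t²`. The estimate makes unital contractive
functionals real on self-adjoint elements. -/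
theorem norm_sub_smul_I_sq_le {a : A} (ha : IsSelfAdjoint a) (t : ℝ) :
    ‖a - (t * Complex.I) • (1 : A)‖ ^ 2 ≤ ‖a‖ ^ 2 + t ^ 2 := by
  rcases subsingleton_or_nontrivial A with _ | _
  · rw [Subsingleton.elim (a - _) 0, Subsingleton.elim a 0]
    simpa using sq_nonneg t
  have h : star (a - (t * Complex.I) • (1 : A)) * (a - (t * Complex.I) • (1 : A)) =
      a * a + ((t : ℂ) ^ 2) • (1 : A) := by
    rw [star_sub, ha.star_eq, star_smul, star_one]
    simp only [sub_mul, mul_sub, mul_smul_comm, smul_mul_assoc, mul_one, one_mul, smul_smul,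
      smul_sub]
    have h1 : star ((t : ℂ) * Complex.I) = -(t * Complex.I) := by simp
    have h2 : (t : ℂ) * Complex.I * (t * Complex.I) = -(t : ℂ) ^ 2 := by
      linear_combination (t : ℂ) ^ 2 * Complex.I_sq
    rw [h1, mul_neg, h2]
    module
  rw [sq, ← CStarRing.norm_star_mul_self, h]
  calc ‖a * a + ((t : ℂ) ^ 2) • (1 : A)‖ ≤ ‖a * a‖ + ‖((t : ℂ) ^ 2) • (1 : A)‖ := norm_add_le _ _
    _ ≤ ‖a‖ ^ 2 + t ^ 2 := by
      gcongr
      · rw [sq]; exact norm_mul_le _ _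
      · rw [norm_smul]; simp

/-- A unital functional of norm at most one is a state. -/
theorem isState_of_norm_le_one {φ : StrongDual ℂ A} (hn : ‖φ‖ ≤ 1) (h1 : φ 1 = 1) :
    IsState φ := by
  refine ⟨fun x => ?_, h1⟩
  let := CStarAlgebra.spectralOrder A
  let := CStarAlgebra.spectralOrderedRing A
  have hle : ∀ y, ‖φ y‖ ≤ ‖y‖ := fun y =>
    (φ.le_opNorm y).trans (mul_le_of_le_one_left (norm_nonneg y) hn)
  set a := star x * x with ha
  have hsa : IsSelfAdjoint a := IsSelfAdjoint.star_mul_self x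
  have ha0 : 0 ≤ a := star_mul_self_nonneg x
  have him : (φ a).im = 0 := by
    have key : ∀ t : ℝ, (φ a).im ^ 2 - 2 * t * (φ a).im ≤ ‖a‖ ^ 2 := by
      intro t
      have h2 := hle (a - (t * Complex.I) • (1 : A))
      rw [map_sub, map_smul, h1, smul_eq_mul, mul_one] at h2
      have h3 := Complex.abs_im_le_norm (φ a - t * Complex.I)
      have h4 : (φ a - t * Complex.I).im = (φ a).im - t := by simp
      rw [h4] at h3
      have h5 := sq_le_sq' (by linarith [abs_nonneg ((φ a).im - t)]) (h3.trans h2)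
      rw [sq_abs] at h5
      linarith [norm_sub_smul_I_sq_le hsa t]
    by_contra hne
    -- This `t` turns `key` into `(Im φ(a))² + ‖a‖² + 1 ≤ ‖a‖²`.
    have := key (-(‖a‖ ^ 2 + 1) / (2 * (φ a).im))
    have h6 : 2 * (-(‖a‖ ^ 2 + 1) / (2 * (φ a).im)) * (φ a).im = -(‖a‖ ^ 2 + 1) := by
      field_simp
    rw [h6] at this
    linarith [sq_nonneg (φ a).im]
  -- From `0 ≤ a ≤ ‖a‖`, the element `‖a‖ - a` has norm at most `‖a‖`, so `φ(a)` lies in the disc of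
  -- radius `‖a‖` about `‖a‖`.
  have hre : 0 ≤ (φ a).re := by
    have h2 : ‖algebraMap ℝ A ‖a‖ - a‖ ≤ ‖a‖ := by
      rw [CStarAlgebra.norm_le_iff_le_algebraMap _ (norm_nonneg a)
        (sub_nonneg.2 hsa.le_algebraMap_norm_self)]
      exact sub_le_self _ ha0
    have h3 := (hle _).trans h2
    have h4 : φ (algebraMap ℝ A ‖a‖ - a) = ‖a‖ - φ a := by
      rw [map_sub, Algebra.algebraMap_eq_smul_one, ← Complex.coe_smul, map_smul, h1,
        smul_eq_mul, mul_one]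
    rw [h4] at h3
    have h5 := (Complex.re_le_norm _).trans h3
    simp at h5
    exact h5
  exact Complex.nonneg_iff.2 ⟨hre, him.symm⟩

/-- A subspace of nonunits is annihilated by a state. -/
theorem exists_isState_forall_mem_eq_zero [Nontrivial A] (M : Submodule ℂ A)
    (hM : ∀ x ∈ M, ¬ IsUnit x) : ∃ φ : StrongDual ℂ A, IsState φ ∧ ∀ x ∈ M, φ x = 0 := by
  obtain ⟨g, hg, hg1⟩ := exists_dual_vector'' ℂ (Submodule.Quotient.mk 1 : A ⧸ M)
  -- Any representative `m` of the class of 1 has `1 - m ∈ M`, a nonunit, whereas `‖m‖ < 1` would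
  -- make `1 - m` invertible.
  have hdist : ‖(Submodule.Quotient.mk 1 : A ⧸ M)‖ = 1 := by
    refine le_antisymm ((Submodule.Quotient.norm_mk_le M 1).trans norm_one.le) ?_
    refine le_of_forall_pos_lt_add fun ε hε => ?_
    obtain ⟨m, hm, hlt⟩ := Submodule.Quotient.norm_mk_lt (Submodule.Quotient.mk 1 : A ⧸ M) hε
    refine lt_of_le_of_lt ?_ hlt
    have h := hM _ ((Submodule.Quotient.eq M).1 hm.symm)
    by_contra! hc
    exact h (isUnit_one_sub_of_norm_lt_one hc)
  refine ⟨LinearMap.mkContinuous (g.toLinearMap.comp M.mkQ) 1 fun x => ?_,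
    isState_of_norm_le_one (LinearMap.mkContinuous_norm_le _ zero_le_one _) ?_, fun x hx => ?_⟩
  · calc ‖g (Submodule.Quotient.mk x)‖ ≤ ‖g‖ * ‖(Submodule.Quotient.mk x : A ⧸ M)‖ := g.le_opNorm _
      _ ≤ 1 * ‖x‖ := by
        gcongr
        exact Submodule.Quotient.norm_mk_le M x
  · change g (Submodule.Quotient.mk 1) = 1
    rw [hg1, hdist]
    simp
  · change g (Submodule.Quotient.mk x) = 0
    rw [(Submodule.Quotient.mk_eq_zero M).2 hx, map_zero]

/-- States detect nonzero positive elements. -/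
theorem eq_zero_of_forall_isState [PartialOrder A] [StarOrderedRing A] {b : A} (hb : 0 ≤ b)
    (h : ∀ φ : StrongDual ℂ A, IsState φ → φ b = 0) : b = 0 := by
  nontriviality A
  -- As `‖b‖` lies in the spectrum, the line through `‖b‖ - b` consists of nonunits. A state
  -- annihilating it takes the value `‖b‖` at `b`.
  have hspec := CStarAlgebra.norm_mem_spectrum_of_nonneg hb
  obtain ⟨φ, hφ, h0⟩ := exists_isState_forall_mem_eq_zero
    (Submodule.span ℂ {algebraMap ℝ A ‖b‖ - b}) fun x hx hu => by
      obtain ⟨c, rfl⟩ := Submodule.mem_span_singleton.1 hx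
      rcases eq_or_ne c 0 with rfl | hc
      · simp at hu
      · exact hspec ((isUnit_smul_iff (Units.mk0 c hc) _).1 hu)
  have := h0 _ (Submodule.mem_span_singleton_self _)
  rw [map_sub, h φ hφ, Algebra.algebraMap_eq_smul_one, ← Complex.coe_smul, map_smul, hφ.2] at this
  simpa using this

end States

/-! ### Proper hereditary subalgebras contain no units. -/

section Hereditary

variable {A : Type*} [CStarAlgebra A] [PartialOrder A] [StarOrderedRing A]

/-- For invertible `b`, `b* b` dominates a positive scalar `r`, so heredity puts 1 in `B`. Then
every positive `a ≤ ‖a‖ · 1` lies in `B`, and positive elements span the algebra. -/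
theorem IsHereditary.eq_top_of_isUnit_mem {B : NonUnitalStarSubalgebra ℂ A} (hB : IsHereditary B)
    {b : A} (hb : b ∈ B) (hu : IsUnit b) : B = ⊤ := by
  nontriviality A
  have hmem : star b * b ∈ B := mul_mem (star_mem hb) hb
  obtain ⟨r, hr, hle⟩ := (CFC.exists_pos_algebraMap_le_iff (a := star b * b)
    (IsSelfAdjoint.star_mul_self b)).2 fun x hx =>
      (CStarAlgebra.isStrictlyPositive_iff_eq_star_mul_self.2 ⟨b, hu, rfl⟩).spectrum_pos hx
  have hr' : algebraMap ℝ A r ∈ B := hB.2 _ _ (by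
    rw [Algebra.algebraMap_eq_smul_one]; exact smul_nonneg hr.le zero_le_one) hle hmem
  have h1 : (1 : A) ∈ B := by
    have := B.smul_mem ((r⁻¹ : ℝ) : ℂ) hr'
    rwa [Complex.coe_smul, Algebra.algebraMap_eq_smul_one, smul_smul, inv_mul_cancel₀ hr.ne',
      one_smul] at this
  have hpos : ∀ a : A, 0 ≤ a → a ∈ B := fun a ha => by
    refine hB.2 a _ ha (IsSelfAdjoint.of_nonneg ha).le_algebraMap_norm_self ?_
    rw [Algebra.algebraMap_eq_smul_one, ← Complex.coe_smul]
    exact B.smul_mem _ h1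
  refine eq_top_iff.2 fun a _ => ?_
  have ha : a ∈ Submodule.span ℂ {a : A | 0 ≤ a} := by
    rw [CStarAlgebra.span_nonneg]; trivial
  exact (Submodule.span_le (p := B.toNonUnitalSubalgebra.toSubmodule)).2 hpos ha

end Hereditary

/-! ### Invariant states by Cesàro averaging. -/

section Invariant

open Filter Topology

variable {A : Type*} [CStarAlgebra A]

/-- The Cesàro averages of a functional along the iterates of an operator. -/
def cesaro (T : A →L[ℂ] A) (φ : StrongDual ℂ A) (N : ℕ) : StrongDual ℂ A :=
  -- Taking `N + 1` terms keeps the average normalized at `N = 0` as well.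
  ((N : ℝ) + 1)⁻¹ • ∑ k ∈ Finset.range (N + 1), φ.comp (T ^ k)

theorem cesaro_apply (T : A →L[ℂ] A) (φ : StrongDual ℂ A) (N : ℕ) (a : A) :
    cesaro T φ N a = ((N : ℝ) + 1)⁻¹ • ∑ k ∈ Finset.range (N + 1), φ ((T ^ k) a) := by
  simp [cesaro]

theorem cesaro_eq_of_forall {T : A →L[ℂ] A} {φ : StrongDual ℂ A} {a : A} {c : ℂ}
    (h : ∀ k, φ ((T ^ k) a) = c) (N : ℕ) : cesaro T φ N a = c := by
  have hN : ((N : ℂ) + 1) ≠ 0 := Nat.cast_add_one_ne_zero N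
  rw [cesaro_apply, Finset.sum_congr rfl fun k _ => h k]
  simp
  field_simp

theorem norm_cesaro_le {T : A →L[ℂ] A} (hT : ∀ a, ‖T a‖ ≤ ‖a‖) (φ : StrongDual ℂ A) (N : ℕ) :
    ‖cesaro T φ N‖ ≤ ‖φ‖ := by
  have hk : ∀ (k : ℕ) a, ‖(T ^ k) a‖ ≤ ‖a‖ := fun k => by
    induction k with
    | zero => simp
    | succ k ih => exact fun a => (ih (T a)).trans (hT a)
  refine ContinuousLinearMap.opNorm_le_bound _ (norm_nonneg φ) fun a => ?_
  have hN : (0 : ℝ) < (N : ℝ) + 1 := by positivity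
  rw [cesaro_apply, norm_smul, norm_inv, Real.norm_of_nonneg hN.le, inv_mul_le_iff₀ hN]
  refine (norm_sum_le_of_le _ fun k _ => (φ.le_opNorm _).trans
    (mul_le_mul_of_nonneg_left (hk k a) (norm_nonneg φ))).trans_eq ?_
  simp

/-- The two sums telescope to a pair of boundary terms, so the failure of invariance is of order `1
/ N`. -/
theorem norm_cesaro_map_sub_le {T : A →L[ℂ] A} (hT : ∀ a, ‖T a‖ ≤ ‖a‖) (φ : StrongDual ℂ A)
    (N : ℕ) (a : A) :
    ‖cesaro T φ N (T a) - cesaro T φ N a‖ ≤ ((N : ℝ) + 1)⁻¹ * (2 * (‖φ‖ * ‖a‖)) := by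
  have hk : ∀ (k : ℕ) a, ‖(T ^ k) a‖ ≤ ‖a‖ := fun k => by
    induction k with
    | zero => simp
    | succ k ih => exact fun a => (ih (T a)).trans (hT a)
  have hN : (0 : ℝ) < (N : ℝ) + 1 := by positivity
  have hsum : ∑ k ∈ Finset.range (N + 1), φ ((T ^ k) (T a)) -
      ∑ k ∈ Finset.range (N + 1), φ ((T ^ k) a) = φ ((T ^ (N + 1)) a) - φ a := by
    rw [← Finset.sum_sub_distrib]
    exact Finset.sum_range_sub (fun k => φ ((T ^ k) a)) (N + 1)
  rw [cesaro_apply, cesaro_apply, ← smul_sub, hsum, norm_smul, norm_inv, Real.norm_of_nonneg hN.le]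
  gcongr
  refine (norm_sub_le _ _).trans ?_
  rw [two_mul]
  refine add_le_add ((φ.le_opNorm _).trans ?_) (φ.le_opNorm _)
  gcongr
  exact hk _ a

/-- A state annihilating a set mapped into itself by `Φ` can be averaged to an invariant state
annihilating the same set. -/
theorem exists_invariantState_forall_mem_eq_zero (Φ : A →⋆ₐ[ℂ] A) {B : Set A}
    (hB : ∀ b ∈ B, Φ b ∈ B) {φ : StrongDual ℂ A} (hφ : IsState φ) (h0 : ∀ b ∈ B, φ b = 0) :
    ∃ ψ ∈ invariantStates Φ, ∀ b ∈ B, ψ b = 0 := by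
  have hΦ : ∀ a, ‖Φ a‖ ≤ ‖a‖ := NonUnitalStarAlgHom.norm_apply_le Φ
  let T : A →L[ℂ] A := Φ.toAlgHom.toLinearMap.mkContinuous 1 fun a => by simpa using hΦ a
  have hT : ∀ a, T a = Φ a := fun a => rfl
  have hT1 : ∀ a, ‖T a‖ ≤ ‖a‖ := hΦ
  -- A free ultrafilter provides one limit for all `a` at once from weak-* compactness. Freeness is
  -- what sends `1 / (N + 1)` to zero along `μ`.
  let μ : Ultrafilter ℕ := hyperfilter ℕ
  obtain ⟨ψ, -, hψ⟩ := (WeakDual.isCompact_closedBall (𝕜 := ℂ) (E := A) 0 ‖φ‖).ultrafilter_le_nhds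
    (μ.map fun N => StrongDual.toWeakDual (cesaro T φ N)) (by
      rw [le_principal_iff, Ultrafilter.mem_coe, Ultrafilter.mem_map]
      refine univ_mem' fun N => ?_
      simpa using norm_cesaro_le hT1 φ N)
  have hlim : ∀ a, Tendsto (fun N => cesaro T φ N a) μ (𝓝 (ψ a)) := fun a =>
    ((WeakDual.eval_continuous a).tendsto ψ).comp hψ
  -- Values constant along an orbit survive the limit; this yields both `ψ 1 = 1` and the vanishing
  -- on `B`.
  have hconst : ∀ {a c}, (∀ k, φ ((T ^ k) a) = c) → ψ a = c := fun {a c} h =>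
    tendsto_nhds_unique (hlim a) (by simpa only [cesaro_eq_of_forall h] using tendsto_const_nhds)
  refine ⟨WeakDual.toStrongDual ψ, ⟨⟨fun a => ?_, ?_⟩, fun a => ?_⟩, fun b hb => ?_⟩
  · refine ge_of_tendsto' (hlim _) fun N => ?_
    rw [cesaro_apply]
    have hk : ∀ (k : ℕ) a, 0 ≤ φ ((T ^ k) (star a * a)) := fun k => by
      induction k with
      | zero => exact hφ.1
      | succ k ih =>
        intro a
        rw [pow_succ]
        change 0 ≤ φ ((T ^ k) (Φ (star a * a)))
        rw [map_mul, map_star]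
        exact ih _
    exact smul_nonneg (by positivity) (Finset.sum_nonneg fun k _ => hk k a)
  · refine hconst fun k => ?_
    have : (T ^ k) 1 = 1 := by
      induction k with
      | zero => rfl
      | succ k ih => rw [pow_succ]; change (T ^ k) (Φ 1) = 1; rw [map_one, ih]
    rw [this, hφ.2]
  · refine sub_eq_zero.1 (tendsto_nhds_unique ((hlim (Φ a)).sub (hlim a)) ?_)
    refine squeeze_zero_norm (fun N => norm_cesaro_map_sub_le hT1 φ N a) ?_
    have h := (tendsto_one_div_add_atTop_nhds_zero_nat (𝕜 := ℝ)).mul_const (2 * (‖φ‖ * ‖a‖))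
    simp only [one_div, zero_mul] at h
    exact h.mono_left Nat.hyperfilter_le_atTop
  · refine hconst fun k => h0 _ ?_
    induction k generalizing b with
    | zero => exact hb
    | succ k ih => rw [pow_succ]; exact ih _ (hB b hb)

end Invariant

/-! ### Weighted averages over a circle of endomorphisms. -/

section Average

variable {A : Type*} [CStarAlgebra A]

/-- The weighted average of a functional `φ` over a one-parameter family of endomorphisms with
period `2π`. -/
def circleAverage (ρ : ℝ → A →⋆ₐ[ℂ] A) (hρ : ∀ a, Continuous fun t => ρ t a) (w : C(ℝ, ℝ))
    (φ : StrongDual ℂ A) : StrongDual ℂ A :=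
  have hc : ∀ a, Continuous fun t => (w t : ℂ) * φ (ρ t a) := fun a => by
    have := hρ a
    fun_prop
  LinearMap.mkContinuousOfExistsBound
    { toFun := fun a => (2 * Real.pi : ℂ)⁻¹ * ∫ t in (0 : ℝ)..2 * Real.pi, (w t : ℂ) * φ (ρ t a)
      map_add' := fun a b => by
        simp only [map_add, mul_add]
        rw [intervalIntegral.integral_add ((hc a).intervalIntegrable _ _)
          ((hc b).intervalIntegrable _ _), mul_add]
      map_smul' := fun c a => by
        simp only [map_smul, smul_eq_mul, mul_left_comm _ c, RingHom.id_apply]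
        rw [intervalIntegral.integral_const_mul, mul_left_comm] } <| by
    obtain ⟨C, hC⟩ := (isCompact_uIcc (a := (0 : ℝ)) (b := 2 * Real.pi)).exists_bound_of_continuousOn
      w.continuous.continuousOn
    refine ⟨‖(2 * Real.pi : ℂ)⁻¹‖ * (C * ‖φ‖ * |2 * Real.pi - 0|), fun a => ?_⟩
    have hC0 : 0 ≤ C := (norm_nonneg _).trans (hC 0 Set.left_mem_uIcc)
    have h := intervalIntegral.norm_integral_le_of_norm_le_const (a := (0 : ℝ)) (b := 2 * Real.pi)
      (f := fun t => (w t : ℂ) * φ (ρ t a)) (C := C * (‖φ‖ * ‖a‖)) fun t ht => by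
        rw [norm_mul, Complex.norm_real]
        refine mul_le_mul (hC t (Set.uIoc_subset_uIcc ht)) ((φ.le_opNorm _).trans ?_)
          (norm_nonneg _) hC0
        gcongr
        exact NonUnitalStarAlgHom.norm_apply_le (ρ t) a
    calc ‖(2 * Real.pi : ℂ)⁻¹ * ∫ t in (0 : ℝ)..2 * Real.pi, (w t : ℂ) * φ (ρ t a)‖
        ≤ ‖(2 * Real.pi : ℂ)⁻¹‖ * (C * (‖φ‖ * ‖a‖) * |2 * Real.pi - 0|) := by
          rw [norm_mul]
          gcongr
      _ = _ := by ring

variable {ρ : ℝ → A →⋆ₐ[ℂ] A} {hρ : ∀ a, Continuous fun t => ρ t a}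

theorem circleAverage_apply (w : C(ℝ, ℝ)) (φ : StrongDual ℂ A) (a : A) :
    circleAverage ρ hρ w φ a =
      (2 * Real.pi : ℂ)⁻¹ * ∫ t in (0 : ℝ)..2 * Real.pi, (w t : ℂ) * φ (ρ t a) := rfl

/-- Positivity makes the integrand real, so order properties of real integrals become available. -/
theorem circleAverage_apply_star_mul_self {w : C(ℝ, ℝ)} {φ : StrongDual ℂ A}
    (hφ : IsState φ) (a : A) :
    circleAverage ρ hρ w φ (star a * a) = (((2 * Real.pi)⁻¹ *
      ∫ t in (0 : ℝ)..2 * Real.pi, w t * (φ (ρ t (star a * a))).re : ℝ) : ℂ) := by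
  rw [circleAverage_apply, Complex.ofReal_mul, ← intervalIntegral.integral_ofReal]
  push_cast
  congr 2
  ext t
  have h : 0 ≤ φ (ρ t (star a * a)) := by
    rw [map_mul, map_star]
    exact hφ.1 _
  exact congrArg (_ * ·) (Complex.ext rfl (Complex.nonneg_iff.1 h).2.symm)

theorem re_apply_star_mul_self_nonneg {φ : StrongDual ℂ A} (hφ : IsState φ) (Φ : A →⋆ₐ[ℂ] A)
    (a : A) : 0 ≤ (φ (Φ (star a * a))).re := by
  rw [map_mul, map_star]
  exact (Complex.nonneg_iff.1 (hφ.1 _)).1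

/-- The average of a state with respect to a nonnegative weight of mean one is a state. -/
theorem isState_circleAverage {w : C(ℝ, ℝ)} (hw : ∀ t, 0 ≤ w t)
    (hw1 : ∫ t in (0 : ℝ)..2 * Real.pi, (w t : ℂ) = 2 * Real.pi) {φ : StrongDual ℂ A}
    (hφ : IsState φ) : IsState (circleAverage ρ hρ w φ) := by
  refine ⟨fun a => ?_, ?_⟩
  · rw [circleAverage_apply_star_mul_self hφ]
    refine Complex.zero_le_real.2 (mul_nonneg (by positivity) ?_)
    exact intervalIntegral.integral_nonneg (by positivity) fun t _ =>
      mul_nonneg (hw t) (re_apply_star_mul_self_nonneg hφ _ a)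
  · simp only [circleAverage_apply, map_one, hφ.2, mul_one, hw1]
    exact inv_mul_cancel₀ (by simp [Real.pi_ne_zero])

/-- If the average of a state vanishes on a positive element, then so does the state. -/
theorem apply_eq_zero_of_circleAverage_eq_zero (h0 : ρ 0 = StarAlgHom.id ℂ A)
    {φ : StrongDual ℂ A} (hφ : IsState φ) {a : A}
    (ha : circleAverage ρ hρ 1 φ (star a * a) = 0) : φ (star a * a) = 0 := by
  rw [circleAverage_apply_star_mul_self hφ, Complex.ofReal_eq_zero, mul_eq_zero,
    or_iff_right (by positivity)] at ha
  by_contra hne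
  have hpos : 0 < (φ (ρ 0 (star a * a))).re := by
    refine lt_of_le_of_ne (re_apply_star_mul_self_nonneg hφ _ a) fun h => hne ?_
    rw [h0] at h
    exact Complex.ext h.symm (Complex.nonneg_iff.1 (hφ.1 a)).2.symm
  have hc : Continuous fun t => φ (ρ t (star a * a)) := φ.continuous.comp (hρ _)
  -- The integrand is continuous, nonnegative, and positive at `t = 0`, where `ρ` is the identity;
  -- so its integral cannot vanish.
  refine (intervalIntegral.integral_pos (f := fun t => (1 : C(ℝ, ℝ)) t * (φ (ρ t (star a * a))).re)
    (by positivity) ?_ (fun t _ => ?_) ⟨0, ⟨le_rfl, by positivity⟩, ?_⟩).ne' ha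
  · exact (by fun_prop : Continuous _).continuousOn
  · simpa using re_apply_star_mul_self_nonneg hφ _ a
  · simpa using hpos

theorem integral_exp_int_mul_I (n : ℤ) :
    ∫ t in (0 : ℝ)..2 * Real.pi, Complex.exp (n * t * Complex.I) =
      if n = 0 then (2 * Real.pi : ℂ) else 0 := by
  split_ifs with h
  · simp [h]
  · have hc : (n * Complex.I : ℂ) ≠ 0 := by simp [h]
    have := integral_exp_mul_complex (a := 0) (b := 2 * Real.pi) hc
    simp only [mul_right_comm _ Complex.I] at this
    rw [this]
    have h2 : (n : ℂ) * ((2 * Real.pi : ℝ) : ℂ) * Complex.I = n * (2 * Real.pi * Complex.I) := by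
      push_cast; ring
    rw [h2, Complex.exp_int_mul_two_pi_mul_I]
    simp

/-- The weight `1 + ε cos (n t)`. -/
def cosWeight (n : ℤ) (ε : ℝ) : C(ℝ, ℝ) := ⟨fun t => 1 + ε * Real.cos (n * t), by fun_prop⟩

theorem cosWeight_nonneg (n : ℤ) {ε : ℝ} (hε : |ε| ≤ 1) (t : ℝ) : 0 ≤ cosWeight n ε t := by
  have h : |ε * Real.cos (n * t)| ≤ 1 := by
    rw [abs_mul]
    exact mul_le_one₀ hε (abs_nonneg _) (Real.abs_cos_le_one _)
  change 0 ≤ 1 + ε * Real.cos (n * t)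
  linarith [neg_le_of_abs_le h]

/-- Splitting the cosine into exponentials leaves only the frequencies `0` and `± n`. -/
theorem integral_cosWeight_mul_exp (n : ℤ) (ε : ℝ) (k : ℤ) :
    ∫ t in (0 : ℝ)..2 * Real.pi, (cosWeight n ε t : ℂ) * Complex.exp (k * t * Complex.I) =
      2 * Real.pi * ((if k = 0 then 1 else 0) +
        ε / 2 * ((if k + n = 0 then 1 else 0) + if k - n = 0 then 1 else 0)) := by
  have h : ∀ t : ℝ, (cosWeight n ε t : ℂ) * Complex.exp (k * t * Complex.I) =
      Complex.exp (k * t * Complex.I) + (ε / 2 * Complex.exp ((k + n : ℤ) * t * Complex.I) +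
        ε / 2 * Complex.exp ((k - n : ℤ) * t * Complex.I)) := by
    intro t
    have h1 : ((k + n : ℤ) : ℂ) * t * Complex.I = k * t * Complex.I + n * t * Complex.I := by
      push_cast; ring
    have h2 : ((k - n : ℤ) : ℂ) * t * Complex.I = k * t * Complex.I + -(n * t) * Complex.I := by
      push_cast; ring
    rw [h1, h2, Complex.exp_add, Complex.exp_add]
    change ((1 + ε * Real.cos (n * t) : ℝ) : ℂ) * _ = _
    push_cast
    rw [Complex.cos]
    ring
  have hi : ∀ (c : ℂ) (m : ℤ), IntervalIntegrable
      (fun t : ℝ => c * Complex.exp (m * t * Complex.I)) MeasureTheory.volume 0 (2 * Real.pi) :=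
    fun c m => (by fun_prop : Continuous _).intervalIntegrable _ _
  simp only [h]
  rw [intervalIntegral.integral_add (by simpa using hi 1 k) ((hi _ _).add (hi _ _)),
    intervalIntegral.integral_add (hi _ _) (hi _ _), intervalIntegral.integral_const_mul,
    intervalIntegral.integral_const_mul]
  simp only [integral_exp_int_mul_I]
  split_ifs <;> ring

end Average

/-! ### Monomials and the torus action on `𝔸_α`. -/

namespace NCTorus

variable {α : ℝ}

variable (α) in
/-- The monomial `U^m V^n`. -/
def monomial (m n : ℤ) : NCTorus α := ((U α ^ m * V α ^ n : unitary (NCTorus α)) : NCTorus α)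

theorem map_unitary_zpow {A B : Type*} [CStarAlgebra A] [CStarAlgebra B] (Φ : A →⋆ₐ[ℂ] B)
    {u : unitary A} {v : unitary B} (h : Φ u = v) (n : ℤ) :
    Φ ((u ^ n : unitary A) : A) = ((v ^ n : unitary B) : B) := by
  let r : unitary A →* unitary B :=
    { toFun := fun u => ⟨Φ u, Unitary.map_mem Φ u.2⟩
      map_one' := Subtype.ext (map_one Φ)
      map_mul' := fun u v => Subtype.ext (map_mul Φ _ _) }
  have hr : r u = v := Subtype.ext h
  exact congrArg Subtype.val ((map_zpow r u n).trans (by rw [hr]))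

variable (α) in
/-- `e^{it} V`. -/
def rotV (t : ℝ) : unitary (NCTorus α) :=
  ⟨(Circle.exp t : ℂ) • (V α : NCTorus α), by
    have h : star (Circle.exp t : ℂ) * Circle.exp t = 1 := by
      rw [Complex.star_def, ← Circle.coe_inv_eq_conj, ← Circle.coe_mul, inv_mul_cancel,
        Circle.coe_one]
    constructor
    · rw [star_smul, smul_mul_smul_comm, h, one_smul, Unitary.coe_star_mul_self]
    · rw [star_smul, smul_mul_smul_comm, mul_comm, h, one_smul]
      exact Unitary.coe_mul_star_self (V α)⟩

theorem coe_zpow_of_coe_eq_smul {A : Type*} [CStarAlgebra A] {u v : unitary A} {c : Circle}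
    (h : (v : A) = (c : ℂ) • (u : A)) (n : ℤ) :
    ((v ^ n : unitary A) : A) = ((c ^ n : Circle) : ℂ) • ((u ^ n : unitary A) : A) := by
  have hnat : ∀ n : ℕ, ((v ^ n : unitary A) : A) =
      ((c ^ n : Circle) : ℂ) • ((u ^ n : unitary A) : A) := fun n => by
    simp [h, smul_pow]
  cases n with
  | ofNat n => simpa using hnat n
  | negSucc n =>
    have hinv : ∀ x : unitary A, ((x⁻¹ : unitary A) : A) = star (x : A) := fun x => rfl
    rw [zpow_negSucc, zpow_negSucc, zpow_negSucc, hinv, hinv, hnat, star_smul,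
      Circle.coe_inv_eq_conj, Complex.star_def]

theorem rel_rot (s t : ℝ) :
    Rel α ((rotU s : unitary (NCTorus α)) : NCTorus α) (rotV α t : NCTorus α) := by
  have h := rel_U_V α
  unfold Rel at h ⊢
  simp only [rotU, rotV, smul_mul_smul_comm]
  rw [h, smul_comm, mul_comm (Circle.exp s : ℂ)]

variable (α) in
/-- The action of the two-torus on `𝔸_α`, `U ↦ e^{is} U` and `V ↦ e^{it} V`. -/
def gauge (s t : ℝ) : NCTorus α →⋆ₐ[ℂ] NCTorus α := lift (rotU s) (rotV α t) (rel_rot s t)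

theorem coe_exp_zpow (x : ℝ) (k : ℤ) :
    ((Circle.exp x ^ k : Circle) : ℂ) = Complex.exp (k * x * Complex.I) := by
  rw [Circle.coe_zpow, Circle.coe_exp, ← Complex.exp_int_mul, mul_assoc]

theorem gauge_monomial (s t : ℝ) (m n : ℤ) :
    gauge α s t (monomial α m n) =
      Complex.exp (m * s * Complex.I) • Complex.exp (n * t * Complex.I) • monomial α m n := by
  have hU := map_unitary_zpow (gauge α s t) (lift_U _ _ (rel_rot s t)) m
  have hV := map_unitary_zpow (gauge α s t) (lift_V _ _ (rel_rot s t)) n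
  rw [monomial, Submonoid.coe_mul, map_mul, hU, hV,
    coe_zpow_of_coe_eq_smul (u := U α) (v := rotU s) (c := Circle.exp s) rfl,
    coe_zpow_of_coe_eq_smul (u := V α) (v := rotV α t) (c := Circle.exp t) rfl, smul_mul_smul_comm, mul_smul,
    coe_exp_zpow, coe_exp_zpow]

theorem gauge_zero : gauge α 0 0 = StarAlgHom.id ℂ (NCTorus α) := by
  refine hom_ext ((lift_U _ _ _).trans ?_) ((lift_V _ _ _).trans ?_) <;> simp [rotU, rotV]

/-- A rotation of `V` alone fixes `U`, hence fixes `f(U)` by naturality of the functional calculus.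
This is why averaging over these rotations preserves invariance of states. -/
theorem gauge_anzai (θ t : ℝ) (f : C(Circle, Circle)) (a : NCTorus α) :
    gauge α 0 t (anzai θ f a) = anzai θ f (gauge α 0 t a) := by
  have hU : gauge α 0 t (U α) = U α := (lift_U _ _ _).trans (by simp [rotU])
  have hV : gauge α 0 t (V α) = (Circle.exp t : ℂ) • (V α : NCTorus α) := lift_V _ _ _
  suffices h : (gauge α 0 t).comp (anzai θ f) = (anzai θ f).comp (gauge α 0 t) from
    DFunLike.congr_fun h a
  refine hom_ext ?_ ?_
  · change gauge α 0 t (anzai θ f (U α)) = anzai θ f (gauge α 0 t (U α))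
    rw [hU, anzai_U, map_smul, hU]
  · change gauge α 0 t (anzai θ f (V α)) = anzai θ f (gauge α 0 t (V α))
    have hn : IsStarNormal (U α : NCTorus α) := isStarNormal_of_mem_unitary (U α).2
    rw [hV, map_smul, anzai_V, map_mul, hV, mul_smul_comm,
      StarAlgHom.map_cfc (gauge α 0 t) (circleFun f) (U α : NCTorus α)
        ((continuousOn_circleFun f).mono (spectrum_U_subset α)) (map_continuous _) hn
        (by rwa [hU]), hU]

/-- Moving `w` past `U^m` costs the scalar `c^m`. It is applied with `k = 1` and `k = -1`. -/
theorem mul_monomial_of_conj {w : unitary (NCTorus α)} {c : Circle} {k : ℤ} (hw : w = V α ^ k)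
    (h : ((w * U α * w⁻¹ : unitary (NCTorus α)) : NCTorus α) = (c : ℂ) • (U α : NCTorus α))
    (m n : ℤ) :
    (w : NCTorus α) * monomial α m n = ((c ^ m : Circle) : ℂ) • monomial α m (k + n) := by
  have h1 := coe_zpow_of_coe_eq_smul h m
  rw [conj_zpow] at h1
  have h2 : w * (U α ^ m * V α ^ n) = (w * U α ^ m * w⁻¹) * (w * V α ^ n) := by group
  rw [monomial, ← Submonoid.coe_mul, h2, Submonoid.coe_mul, h1, smul_mul_assoc,
    ← Submonoid.coe_mul, hw, ← zpow_add, monomial]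

variable (α) in
theorem conj_V_U : ((V α * U α * (V α)⁻¹ : unitary (NCTorus α)) : NCTorus α) =
    (Circle.exp (-(2 * Real.pi * α)) : ℂ) • (U α : NCTorus α) := by
  have h := rel_U_V α
  unfold Rel at h
  have h2 : (V α : NCTorus α) * U α =
      (Circle.exp (-(2 * Real.pi * α)) : ℂ) • ((U α : NCTorus α) * V α) := by
    rw [h, smul_smul, Circle.coe_exp, ← Complex.exp_add]
    have : ((-(2 * Real.pi * α) : ℝ) : ℂ) * Complex.I + 2 * Real.pi * Complex.I * α = 0 := by
      push_cast; ring
    rw [this, Complex.exp_zero, one_smul]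
  rw [Submonoid.coe_mul, Submonoid.coe_mul, h2, smul_mul_assoc, ← Submonoid.coe_mul,
    ← Submonoid.coe_mul, mul_inv_cancel_right]

variable (α) in
theorem conj_inv_V_U : (((V α)⁻¹ * U α * (V α)⁻¹⁻¹ : unitary (NCTorus α)) : NCTorus α) =
    (((Circle.exp (-(2 * Real.pi * α)))⁻¹ : Circle) : ℂ) • (U α : NCTorus α) := by
  have h : (U α : NCTorus α) = (Circle.exp (-(2 * Real.pi * α)) : ℂ) •
      (((V α)⁻¹ * U α * (V α)⁻¹⁻¹ : unitary (NCTorus α)) : NCTorus α) := by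
    have h1 : U α = (V α)⁻¹ * (V α * U α * (V α)⁻¹) * V α := by group
    conv_lhs => rw [h1]
    rw [Submonoid.coe_mul, Submonoid.coe_mul, conj_V_U, mul_smul_comm, smul_mul_assoc,
      ← Submonoid.coe_mul, ← Submonoid.coe_mul, inv_inv]
  conv_rhs => rw [h]
  rw [smul_smul, ← Circle.coe_mul, inv_mul_cancel, Circle.coe_one, one_smul]

-- The span contains 1 and is stable under left multiplication by `U`, `V` and their inverses, hence
-- by every word; so it contains the dense image of the free algebra.
variable (α) in
theorem dense_span_monomial :
    Dense (Submodule.span ℂ (Set.range fun k : ℤ × ℤ => monomial α k.1 k.2) : Set (NCTorus α)) := by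
  set S := Submodule.span ℂ (Set.range fun k : ℤ × ℤ => monomial α k.1 k.2)
  have hmem : ∀ m n, monomial α m n ∈ S := fun m n => Submodule.subset_span ⟨(m, n), rfl⟩
  have hmul : ∀ y : NCTorus α, (∀ m n, y * monomial α m n ∈ S) → ∀ x ∈ S, y * x ∈ S := by
    intro y hy x hx
    induction hx using Submodule.span_induction with
    | mem x hx => obtain ⟨k, rfl⟩ := hx; exact hy _ _
    | zero => simp
    | add a b _ _ ha hb => rw [mul_add]; exact S.add_mem ha hb
    | smul c a _ ha => rw [mul_smul_comm]; exact S.smul_mem c ha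
  have hU : ∀ k : ℤ, ∀ x ∈ S, ((U α ^ k : unitary (NCTorus α)) : NCTorus α) * x ∈ S := by
    refine fun k => hmul _ fun m n => ?_
    rw [monomial, ← Submonoid.coe_mul, ← mul_assoc, ← zpow_add]
    exact hmem _ _
  have hV : ∀ x ∈ S, (V α : NCTorus α) * x ∈ S := hmul _ fun m n => by
    rw [mul_monomial_of_conj (zpow_one _).symm (conj_V_U α)]
    exact S.smul_mem _ (hmem _ _)
  have hV' : ∀ x ∈ S, (((V α)⁻¹ : unitary (NCTorus α)) : NCTorus α) * x ∈ S :=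
    hmul _ fun m n => by
      rw [mul_monomial_of_conj (zpow_neg_one _).symm (conj_inv_V_U α)]
      exact S.smul_mem _ (hmem _ _)
  have hg : ∀ g : FreeGroup (Fin 2), ∀ x ∈ S, of (PreNCTorus.mono g 1) * x ∈ S := by
    intro g
    induction g using FreeGroup.induction_on with
    | C1 => intro x hx; rwa [PreNCTorus.mono_one, of_one, one_mul]
    | of i =>
      fin_cases i
      · have h := hU 1
        rw [zpow_one] at h
        exact h
      · exact hV
    | inv_of i hi =>
      have hstar : of (PreNCTorus.mono (FreeGroup.of i)⁻¹ 1 : PreNCTorus α) =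
          star (of (PreNCTorus.mono (FreeGroup.of i) 1)) := by
        rw [star_of, PreNCTorus.star_mono, star_one]
      rw [hstar]
      fin_cases i
      · have h := hU (-1)
        rw [zpow_neg_one] at h
        exact h
      · exact hV'
    | mul g h hg hh =>
      intro x hx
      rw [← mul_one (1 : ℂ), ← PreNCTorus.mono_mul, of_mul, mul_assoc]
      exact hg _ (hh _ hx)
  have hone : (1 : NCTorus α) ∈ S := by simpa [monomial] using hmem 0 0
  refine denseRange_of.mono ?_
  rintro _ ⟨x, rfl⟩
  induction x using PreNCTorus.induct with
  | h0 => rw [of_zero]; exact S.zero_mem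
  | hadd x y hx hy => rw [of_add]; exact S.add_mem hx hy
  | hs g c =>
    rw [← mul_one c, ← PreNCTorus.smul_mono, of_smul]
    exact S.smul_mem c (by simpa using hg g 1 hone)

theorem functional_ext {φ ψ : StrongDual ℂ (NCTorus α)}
    (h : ∀ m n, φ (monomial α m n) = ψ (monomial α m n)) : φ = ψ :=
  ContinuousLinearMap.ext_on (dense_span_monomial α) (by rintro _ ⟨k, rfl⟩; exact h _ _)

/-- Continuity is explicit on monomials and passes to the closure of their span because every
`gauge` map is contractive. -/
theorem continuous_gauge {X : Type*} [TopologicalSpace X] {s t : X → ℝ} (hs : Continuous s)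
    (ht : Continuous t) (a : NCTorus α) : Continuous fun x => gauge α (s x) (t x) a := by
  rw [continuous_iff_continuousAt]
  intro x₀
  have hlip : ∀ x, LipschitzWith 1 (gauge α (s x) (t x)) := fun x =>
    AddMonoidHomClass.lipschitz_of_bound_nnnorm _ 1 fun a => by
      rw [one_mul]
      exact NonUnitalStarAlgHom.norm_apply_le (gauge α (s x) (t x)) a
  have hspan : ∀ a ∈ Submodule.span ℂ (Set.range fun k : ℤ × ℤ => monomial α k.1 k.2),
      Continuous fun x => gauge α (s x) (t x) a := by
    intro a ha
    induction ha using Submodule.span_induction with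
    | mem x hx =>
      obtain ⟨k, rfl⟩ := hx
      simp only [gauge_monomial]
      fun_prop
    | zero => simpa using continuous_const
    | add a b _ _ ha hb => simp only [map_add]; exact ha.add hb
    | smul c a _ ha => simp only [map_smul]; exact ha.const_smul c
  rw [Metric.continuousAt_iff']
  intro ε hε
  obtain ⟨b, hb, hab⟩ := Metric.mem_closure_iff.1 (dense_span_monomial α a) (ε / 3) (by positivity)
  have h := Metric.continuousAt_iff'.1 ((hspan b hb).continuousAt (x := x₀)) (ε / 3) (by positivity)
  filter_upwards [h] with x hx
  have h1 := (hlip x).dist_le_mul a b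
  have h2 := (hlip x₀).dist_le_mul b a
  rw [NNReal.coe_one, one_mul] at h1 h2
  rw [dist_comm b a] at h2
  have h3 := dist_triangle4 (gauge α (s x) (t x) a) (gauge α (s x) (t x) b)
    (gauge α (s x₀) (t x₀) b) (gauge α (s x₀) (t x₀) a)
  linarith

/-! ### Faithfulness of the trace and unique ergodicity. -/

theorem trace_apply_monomial (m n : ℤ) :
    trace α (monomial α m n) = if m = 0 ∧ n = 0 then 1 else 0 := trace_monomial m n

theorem monomial_zero_zero : monomial α 0 0 = 1 := by simp [monomial]

instance : Nontrivial (NCTorus α) := by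
  refine ⟨⟨1, 0, fun h => ?_⟩⟩
  have := trace_apply_monomial (α := α) 0 0
  rw [monomial_zero_zero, h, map_zero] at this
  simp at this

/-- The average of a functional over the rotations of `U`. -/
def averageU (φ : StrongDual ℂ (NCTorus α)) : StrongDual ℂ (NCTorus α) :=
  circleAverage (fun s => gauge α s 0) (continuous_gauge continuous_id continuous_const) 1 φ

/-- The weighted average of a functional over the rotations of `V`. -/
def averageV (w : C(ℝ, ℝ)) (φ : StrongDual ℂ (NCTorus α)) : StrongDual ℂ (NCTorus α) :=
  circleAverage (fun t => gauge α 0 t) (continuous_gauge continuous_const continuous_id) w φ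

theorem averageU_monomial (φ : StrongDual ℂ (NCTorus α)) (m n : ℤ) :
    averageU φ (monomial α m n) = if m = 0 then φ (monomial α m n) else 0 := by
  have h := integral_exp_int_mul_I m
  have hπ : (Real.pi : ℂ) ≠ 0 := by simp [Real.pi_ne_zero]
  simp only [averageU, circleAverage_apply, gauge_monomial, map_smul, smul_eq_mul,
    intervalIntegral.integral_mul_const, h, ContinuousMap.one_apply, Complex.ofReal_one, one_mul,
    Complex.ofReal_zero, mul_zero, zero_mul, Complex.exp_zero]
  split_ifs
  · field_simp
  · simp

theorem averageV_monomial (k : ℤ) (ε : ℝ) (φ : StrongDual ℂ (NCTorus α)) (m n : ℤ) :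
    averageV (cosWeight k ε) φ (monomial α m n) = ((if n = 0 then 1 else 0) +
        ε / 2 * ((if n + k = 0 then 1 else 0) + if n - k = 0 then 1 else 0)) *
        φ (monomial α m n) := by
  have h := integral_cosWeight_mul_exp k ε n
  have hπ : (Real.pi : ℂ) ≠ 0 := by simp [Real.pi_ne_zero]
  simp only [averageV, circleAverage_apply, gauge_monomial, map_smul, smul_eq_mul,
    Complex.ofReal_zero, mul_zero, zero_mul, Complex.exp_zero, one_mul]
  simp only [← mul_assoc]
  rw [intervalIntegral.integral_mul_const, h]
  field_simp

/-- Averaging over both circles kills every Fourier coefficient except the one at `(0, 0)`, where a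
state has value 1. -/
theorem averageV_averageU {φ : StrongDual ℂ (NCTorus α)} (hφ : IsState φ) :
    averageV 1 (averageU φ) = trace α := by
  refine functional_ext fun m n => ?_
  have hw : (1 : C(ℝ, ℝ)) = cosWeight 0 0 := by ext; simp [cosWeight]
  rw [hw, averageV_monomial, averageU_monomial, trace_apply_monomial]
  by_cases hm : m = 0 <;> by_cases hn : n = 0 <;> simp [hm, hn, monomial_zero_zero, hφ.2]

/-- The canonical trace is faithful. -/
theorem eq_zero_of_trace_eq_zero {b : NCTorus α} (hb : 0 ≤ b) (h : trace α b = 0) : b = 0 := by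
  refine eq_zero_of_forall_isState hb fun φ hφ => ?_
  obtain ⟨c, rfl⟩ := CStarAlgebra.nonneg_iff_eq_star_mul_self.1 hb
  -- The trace is a double average of `φ`, so its vanishing at `c* c` passes back through the two
  -- averages to `φ` itself.
  rw [← averageV_averageU hφ] at h
  have hU : IsState (averageU φ) := isState_circleAverage (fun _ => zero_le_one) (by simp) hφ
  exact apply_eq_zero_of_circleAverage_eq_zero (ρ := fun s => gauge α s 0) gauge_zero hφ
    (apply_eq_zero_of_circleAverage_eq_zero (ρ := fun t => gauge α 0 t) gauge_zero hU h)

/-- Invariance gives `e^{imθ} φ(U^m) = φ(U^m)`, and irrationality excludes `e^{imθ} = 1`. -/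
theorem apply_monomial_zero_eq_zero {θ : ℝ} (hθ : Irrational (θ / (2 * Real.pi)))
    {f : C(Circle, Circle)} {φ : StrongDual ℂ (NCTorus α)} (hφ : ∀ a, φ (anzai θ f a) = φ a)
    {m : ℤ} (hm : m ≠ 0) : φ (monomial α m 0) = 0 := by
  have h1 := map_unitary_zpow (anzai (α := α) θ f) (u := U α) (v := rotU θ) (anzai_U θ f) m
  rw [coe_zpow_of_coe_eq_smul (u := U α) (v := rotU θ) (c := Circle.exp θ) rfl] at h1
  have h2 : monomial α m 0 = ((U α ^ m : unitary (NCTorus α)) : NCTorus α) := by simp [monomial]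
  have h3 := hφ (monomial α m 0)
  rw [h2, h1, map_smul, smul_eq_mul, coe_exp_zpow] at h3
  rw [h2]
  by_contra hne
  obtain ⟨k, hk⟩ := Complex.exp_eq_one_iff.1 (mul_right_cancel₀ hne (h3.trans (one_mul _).symm))
  rw [← mul_assoc] at hk
  have hk' : (m : ℝ) * θ = k * (2 * Real.pi) := by
    exact_mod_cast mul_right_cancel₀ Complex.I_ne_zero hk
  refine hθ ⟨k / m, ?_⟩
  have hm' : (m : ℝ) ≠ 0 := Int.cast_ne_zero.2 hm
  have := Real.pi_pos
  push_cast
  field_simp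
  linarith

/-- If the canonical trace is ergodic, it is the only invariant state. -/
theorem eq_trace_of_mem_invariantStates {θ : ℝ} (hθ : Irrational (θ / (2 * Real.pi)))
    {f : C(Circle, Circle)} (herg : IsErgodicState (anzai θ f) (trace α))
    {φ : StrongDual ℂ (NCTorus α)} (hφ : φ ∈ invariantStates (anzai θ f)) : φ = trace α := by
  have hU : ∀ {m : ℤ}, m ≠ 0 → φ (monomial α m 0) = 0 := apply_monomial_zero_eq_zero hθ hφ.2
  have h1 : φ (monomial α 0 0) = 1 := by rw [monomial_zero_zero, hφ.1.2]
  refine functional_ext fun m n => ?_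
  rw [trace_apply_monomial]
  by_cases hn : n = 0
  · subst hn
    by_cases hm : m = 0
    · simp [hm, h1]
    · simp [hm, hU hm]
  -- The weight has mean one because `n ≠ 0`, and is nonnegative because `|ε| ≤ 1`.
  have hinv : ∀ ε : ℝ, |ε| ≤ 1 → averageV (cosWeight n ε) φ ∈ invariantStates (anzai θ f) := by
    intro ε hε
    refine ⟨isState_circleAverage (cosWeight_nonneg n hε) ?_ hφ.1, fun a => ?_⟩
    · simpa [hn] using integral_cosWeight_mul_exp n ε 0
    · simp only [averageV, circleAverage_apply, gauge_anzai, hφ.2]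
  -- In the midpoint the cosine terms cancel, leaving `φ` on powers of `U` and zero on other
  -- monomials; as `φ(U^p) = 0` for `p ≠ 0`, this is the trace.
  have hseg : trace α ∈ openSegment ℝ (averageV (cosWeight n 1) φ)
      (averageV (cosWeight n (-1)) φ) := by
    refine ⟨1 / 2, 1 / 2, by norm_num, by norm_num, by norm_num, functional_ext fun p q => ?_⟩
    rw [add_apply, smul_apply, smul_apply, averageV_monomial, averageV_monomial, trace_apply_monomial,
      ← Complex.coe_smul, ← Complex.coe_smul]
    by_cases hq : q = 0
    · subst hq
      by_cases hp : p = 0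
      · subst hp
        simp [h1, hn]
        norm_num
      · simp [hp, hU hp]
    · simp only [hq, and_false, if_false, smul_eq_mul]
      push_cast
      ring
  have key := (mem_extremePoints.1 herg).2 _ (hinv 1 (by simp)) _ (hinv (-1) (by simp)) hseg
  have h2 := DFunLike.congr_fun key.1 (monomial α m n)
  rw [averageV_monomial, trace_apply_monomial] at h2
  -- Only the Kronecker term for `n - n` survives in `h2`, which now reads `φ(U^m V^n) / 2 = 0`.
  have hnn : n + n ≠ 0 := by omega
  simpa [hn, hnn] using h2

end NCTorus

end

theorem mainTheorem9 (α θ : ℝ) (hθ : Irrational (θ / (2 * Real.pi))) (f : C(Circle, Circle))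
    (herg : IsErgodicState (NCTorus.anzai θ f) (NCTorus.trace α)) :
    IsMinimalSystem (NCTorus.anzai (α := α) θ f) := by
  intro B
  constructor
  · rintro ⟨hB, hinv, hne⟩
    by_contra htop
    obtain ⟨φ, hφ, h0⟩ := exists_isState_forall_mem_eq_zero
      B.toNonUnitalSubalgebra.toSubmodule fun x hx hu => htop (hB.eq_top_of_isUnit_mem hx hu)
    obtain ⟨ψ, hψ, hψ0⟩ := exists_invariantState_forall_mem_eq_zero (NCTorus.anzai θ f)
      (B := (B : Set (NCTorus α))) hinv hφ h0
    obtain rfl := NCTorus.eq_trace_of_mem_invariantStates hθ herg hψ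
    refine hne ((eq_bot_iff).2 fun b hb => ?_)
    -- Faithfulness applies to positive elements, hence the passage from `b` to `b* b ∈ B`.
    have h := NCTorus.eq_zero_of_trace_eq_zero (star_mul_self_nonneg b)
      (hψ0 _ (mul_mem (star_mem hb) hb))
    exact NonUnitalStarAlgebra.mem_bot.2 ((CStarRing.star_mul_self_eq_zero_iff b).1 h)
  · rintro rfl
    refine ⟨⟨isClosed_univ, fun _ _ _ _ _ => trivial⟩, fun _ _ => trivial, fun h => ?_⟩
    have h1 : (1 : NCTorus α) ∈ (⊥ : NonUnitalStarSubalgebra ℂ (NCTorus α)) := h ▸ trivial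
    exact one_ne_zero ((NonUnitalStarAlgebra.mem_bot).1 h1)
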